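/- Let $n, m \ge 0$, $r \ge 2$ and $c \ge 1$ be integers, and let $\phi_1, \ldots, \phi_m : \mathbb{R}^n \to \mathbb{C}$ be functions such that: 1. each $\phi_i$ is 1-Lipschitz in the $\ell^1$ metric: $|\phi_i(x) - \phi_i(y)| \le \sum_{j=1}^n |x_j - y_j|$ for all $x, y \in \mathbb{R}^n$; 2. each $\phi_i$ depends on at most $r$ coordinates: there is a set $J_i \subset \{1, \ldots, n\}$ with $|J_i| \le r$ such that $\phi_i(x) = \phi_i(y)$ whenever $x_j = y_j$ for all $j \in J_i$; 3. each coordinate is used by at most $c$ of the functions: $|\{i : j \in J_i\}| \le c$ for every $j = 1, \ldots, n$. Let $f = \sum_{i=1}^m \phi_i$, let $\mathbf{E}$ denote the expectation with respect to the standard Gaussian probability measure on $\mathbb{R}^n$, which has density $(2\pi)^{-n/2} \exp\{-\frac12 (x_1^2 + \cdots + x_n^2)\}$, and let $\lambda \in \mathbb{C}$ satisfy $$|\lambda| < \frac{1}{6c\sqrt{r-1}}.$$ Then $$\mathbf{E}\, e^{\lambda f} \ne 0.$$ Moreover, if, additionally, $|\phi_i(x)| \le L$ for all $x \in \mathbb{R}^n$,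 all $i = 1, \ldots, m$ and some $L > 0$, then $$e^{-|\lambda| m L}\, e^{-\pi^2 n/(32 r)} \le \left|\mathbf{E}\, e^{\lambda f}\right| \le e^{|\lambda| m L}.$$ -/

import Mathlib

open MeasureTheory ProbabilityTheory

/-! Integrate out one coordinate at a time and show that each integration loses at most a factor `q`
to cancellation. By induction on `S`, the expectation over `S` is nonzero and its modulus is at
least `q ^ |A|` times the expectation over `A` of the modulus of the expectation over `S \ A`, for
every `A ⊆ S` (`HasLittleCancellation`).

Vary a coordinate `j ∉ S`. The logarithmic derivative of the expectation over `S` involves only the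
at most `c` functions using `j`, and the increment of each sees at most `r - 1` coordinates of `S`.
Taking these as `A`, the bound for `S` makes the logarithm Lipschitz in `x j` with constant `β = |λ|
c q^{-(r-1)}` (`HasLittleCancellation.exists_log`). A function of one Gaussian variable with such a
logarithm keeps a proportion `1 - 2β²` of its mass (`norm_integral_ge_of_logLipschitz`), so the
induction closes once `β ≤ 1/4` and `q ≤ 1 - 2β²`; `q = exp(-π²/(32r))` satisfies both. The
derivative is taken along a path of families, so the induction must cover all local families at
once. -/

/-- The standard Gaussian measure on the product space `ι → ℝ`. -/
noncomputable def gaussPi (ι : Type*) [Fintype ι] : Measure (ι → ℝ) :=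
  Measure.pi fun _ => gaussianReal 0 1

instance gaussPi_isProbabilityMeasure (ι : Type*) [Fintype ι] :
    IsProbabilityMeasure (gaussPi ι) := by
  unfold gaussPi; infer_instance

/-! ### Averaging over a set of coordinates, and Fubini. -/

section PartialExpectation

variable {ι : Type*} [Fintype ι] [DecidableEq ι] {E : Type*} [NormedAddCommGroup E]
  [NormedSpace ℝ E]

/-- The expectation over the coordinates in `S`, the others being kept fixed. -/
noncomputable def partialExp (S : Finset ι) (h : (ι → ℝ) → E) (x : ι → ℝ) : E :=
  ∫ y, h (S.piecewise y x) ∂gaussPi ι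

/-- Strongly measurable functions of at most exponential growth. -/
structure ExpGrowth (h : (ι → ℝ) → E) : Prop where
  stronglyMeasurable : StronglyMeasurable h
  bound : ∃ C K : ℝ, 0 ≤ C ∧ 0 ≤ K ∧ ∀ x, ‖h x‖ ≤ C * Real.exp (K * ∑ j, |x j|)

omit [DecidableEq ι] in
lemma integrable_exp_mul_sum_abs (K : ℝ) :
    Integrable (fun x : ι → ℝ => Real.exp (K * ∑ j, |x j|)) (gaussPi ι) := by
  have h : Integrable (fun t : ℝ => Real.exp (K * |t|)) (gaussianReal 0 1) :=
    integrable_exp_mul_abs (integrable_exp_mul_gaussianReal K)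
      (by simpa using integrable_exp_mul_gaussianReal (-K))
  have := Integrable.fintype_prod (ι := ι) (f := fun _ t => Real.exp (K * |t|)) (fun _ => h)
  simpa only [← Real.exp_sum, ← Finset.mul_sum, gaussPi] using this

omit [DecidableEq ι] [NormedSpace ℝ E] in
lemma ExpGrowth.norm {h : (ι → ℝ) → E} (hh : ExpGrowth h) : ExpGrowth (fun x => ‖h x‖) := by
  obtain ⟨C, K, hC, hK, hb⟩ := hh.bound
  exact ⟨hh.1.norm, C, K, hC, hK, by simpa using hb⟩

omit [Fintype ι] in
lemma measurable_piecewise_prod (S : Finset ι) :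
    Measurable fun p : (ι → ℝ) × (ι → ℝ) => S.piecewise p.1 p.2 := by
  refine measurable_pi_lambda _ fun i => ?_
  by_cases hi : i ∈ S <;> simp only [Finset.piecewise, hi, if_true, if_false] <;> fun_prop

lemma sum_abs_piecewise_le (S : Finset ι) (y x : ι → ℝ) :
    ∑ j, |S.piecewise y x j| ≤ ∑ j, |y j| + ∑ j, |x j| := by
  rw [← Finset.sum_add_distrib]
  refine Finset.sum_le_sum fun j _ => ?_
  by_cases hj : j ∈ S <;> simp [Finset.piecewise, hj]

omit [NormedSpace ℝ E] in
lemma ExpGrowth.norm_piecewise_le {h : (ι → ℝ) → E} {C K : ℝ} (hC : 0 ≤ C) (hK : 0 ≤ K)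
    (hb : ∀ x, ‖h x‖ ≤ C * Real.exp (K * ∑ j, |x j|)) (S : Finset ι) (y x : ι → ℝ) :
    ‖h (S.piecewise y x)‖ ≤
      C * Real.exp (K * ∑ j, |x j|) * Real.exp (K * ∑ j, |y j|) := by
  refine (hb _).trans ?_
  rw [mul_assoc, ← Real.exp_add, ← mul_add, add_comm]
  gcongr
  exact sum_abs_piecewise_le S y x

omit [NormedSpace ℝ E] in
lemma ExpGrowth.integrable_piecewise {h : (ι → ℝ) → E} (hh : ExpGrowth h) (S : Finset ι)
    (x : ι → ℝ) : Integrable (fun y => h (S.piecewise y x)) (gaussPi ι) := by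
  obtain ⟨C, K, hC, hK, hb⟩ := hh.bound
  refine ((integrable_exp_mul_sum_abs K).const_mul (C * Real.exp (K * ∑ j, |x j|))).mono' ?_
    (ae_of_all _ fun y => ExpGrowth.norm_piecewise_le hC hK hb S y x)
  exact (hh.1.comp_measurable ((measurable_piecewise_prod S).comp
    measurable_prodMk_right)).aestronglyMeasurable

lemma ExpGrowth.partialExp {h : (ι → ℝ) → E} (hh : ExpGrowth h) (S : Finset ι) :
    ExpGrowth (partialExp S h) := by
  obtain ⟨C, K, hC, hK, hb⟩ := hh.bound
  refine ⟨?_, C * ∫ y, Real.exp (K * ∑ j, |y j|) ∂gaussPi ι, K, ?_, hK, fun x => ?_⟩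
  · exact (hh.1.comp_measurable (measurable_piecewise_prod S)).integral_prod_left'
      (μ := gaussPi ι)
  · exact mul_nonneg hC (integral_nonneg fun _ => (Real.exp_pos _).le)
  · calc _ ≤ ∫ y, C * Real.exp (K * ∑ j, |x j|) * Real.exp (K * ∑ j, |y j|) ∂gaussPi ι :=
          norm_integral_le_of_norm_le ((integrable_exp_mul_sum_abs K).const_mul _)
            (ae_of_all _ fun y => ExpGrowth.norm_piecewise_le hC hK hb S y x)
      _ = _ := by rw [integral_const_mul]; ring

/-- Coordinates are independent, so splicing two independent Gaussian vectors gives a Gaussian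
vector. This yields Fubini without splitting the index type. -/
lemma measurePreserving_piecewise (S : Finset ι) :
    MeasurePreserving (fun p : (ι → ℝ) × (ι → ℝ) => S.piecewise p.1 p.2)
      ((gaussPi ι).prod (gaussPi ι)) (gaussPi ι) := by
  refine ⟨measurable_piecewise_prod S, ?_⟩
  symm
  conv_lhs => unfold gaussPi
  refine Measure.pi_eq fun s hs => ?_
  rw [Measure.map_apply (measurable_piecewise_prod S) (MeasurableSet.univ_pi hs)]
  have : (fun p : (ι → ℝ) × (ι → ℝ) => S.piecewise p.1 p.2) ⁻¹' Set.univ.pi s =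
      (Set.univ.pi (S.piecewise s fun _ => Set.univ)) ×ˢ
        (Set.univ.pi (S.piecewise (fun _ => Set.univ) s)) := by
    ext p
    simp only [Set.mem_preimage, Set.mem_pi, Set.mem_univ, true_imp_iff, Set.mem_prod,
      Finset.piecewise, ← forall_and]
    refine forall_congr' fun i => ?_
    by_cases hi : i ∈ S <;> simp [hi]
  rw [this, Measure.prod_prod, gaussPi, Measure.pi_pi, Measure.pi_pi, ← Finset.prod_mul_distrib]
  refine Finset.prod_congr rfl fun i _ => ?_
  by_cases hi : i ∈ S <;> simp [hi]

/-- Disjointness is not needed: on the overlap the inner variable overwrites the outer one. -/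
lemma partialExp_union {h : (ι → ℝ) → E} (hh : ExpGrowth h) (A B : Finset ι) (x : ι → ℝ) :
    partialExp (A ∪ B) h x = partialExp A (partialExp B h) x := by
  have hmp := measurePreserving_piecewise B
  have hm : StronglyMeasurable fun y => h ((A ∪ B).piecewise y x) :=
    hh.1.comp_measurable ((measurable_piecewise_prod _).comp measurable_prodMk_right)
  have hpw : ∀ y' y : ι → ℝ, (A ∪ B).piecewise (B.piecewise y' y) x =
      B.piecewise y' (A.piecewise y x) := by
    intro y' y
    ext i
    by_cases hA : i ∈ A <;> by_cases hB : i ∈ B <;> simp [Finset.piecewise, hA, hB]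
  unfold partialExp
  rw [← hmp.map_eq, integral_map hmp.measurable.aemeasurable hm.aestronglyMeasurable,
    hmp.map_eq]
  have hint := (hmp.integrable_comp hm.aestronglyMeasurable).2 (hh.integrable_piecewise _ x)
  have := integral_prod_symm _ hint
  simp only [Function.comp_apply, hpw] at this
  simpa only [hpw] using this

omit [NormedSpace ℝ E] in
lemma ExpGrowth.integrable_update {h : (ι → ℝ) → E} (hh : ExpGrowth h) (a : ι) (x : ι → ℝ) :
    Integrable (fun t => h (Function.update x a t)) (gaussianReal 0 1) := by
  have hmp : MeasurePreserving (Function.eval a) (gaussPi ι) (gaussianReal 0 1) :=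
    measurePreserving_eval _ a
  have hm : StronglyMeasurable fun t => h (Function.update x a t) :=
    hh.1.comp_measurable (measurable_update x)
  refine (hmp.integrable_comp hm.aestronglyMeasurable).1 ?_
  simpa [Function.comp_def, Finset.piecewise_singleton] using hh.integrable_piecewise {a} x

lemma partialExp_singleton {h : (ι → ℝ) → E} (hh : ExpGrowth h) (a : ι) (x : ι → ℝ) :
    partialExp {a} h x = ∫ t, h (Function.update x a t) ∂gaussianReal 0 1 := by
  have hmp : MeasurePreserving (Function.eval a) (gaussPi ι) (gaussianReal 0 1) :=
    measurePreserving_eval _ a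
  have hm : StronglyMeasurable fun t => h (Function.update x a t) :=
    hh.1.comp_measurable (measurable_update x)
  rw [← hmp.map_eq, integral_map hmp.measurable.aemeasurable hm.aestronglyMeasurable]
  simp [partialExp, Finset.piecewise_singleton]

@[simp]
lemma partialExp_empty (h : (ι → ℝ) → E) [CompleteSpace E] (x : ι → ℝ) :
    partialExp ∅ h x = h x := by
  simp [partialExp]

end PartialExpectation

/-! ### Gaussian integrals on the line. -/

lemma integrable_cosh_gaussianReal (a : ℝ) :
    Integrable (fun t => Real.cosh (a * t)) (gaussianReal 0 1) := by
  simp only [Real.cosh_eq]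
  exact ((integrable_exp_mul_gaussianReal a).add
    (by simpa using integrable_exp_mul_gaussianReal (-a))).div_const 2

lemma integral_cosh_gaussianReal (a : ℝ) :
    ∫ t, Real.cosh (a * t) ∂gaussianReal 0 1 = Real.exp (a ^ 2 / 2) := by
  have h : ∀ b : ℝ, ∫ t, Real.exp (b * t) ∂gaussianReal 0 1 = Real.exp (b ^ 2 / 2) := by
    intro b
    have := congrFun (mgf_fun_id_gaussianReal (μ := 0) (v := 1)) b
    simpa [mgf] using this
  simp only [Real.cosh_eq]
  rw [integral_div, integral_add (integrable_exp_mul_gaussianReal a)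
    (by simpa using integrable_exp_mul_gaussianReal (-a)), h]
  simp_rw [← neg_mul]
  rw [h]
  simp

lemma integrable_sq_gaussianReal : Integrable (fun t : ℝ => t ^ 2) (gaussianReal 0 1) := by
  simpa using (memLp_id_gaussianReal (μ := 0) (v := 1) 2).integrable_sq

lemma integral_sq_gaussianReal : ∫ t, t ^ 2 ∂gaussianReal 0 1 = 1 := by
  have := variance_id_gaussianReal (μ := 0) (v := 1)
  rw [variance_eq_integral (by fun_prop)] at this
  simpa using this

lemma half_sq_le_cosh_sub_one (t : ℝ) : t ^ 2 / 2 ≤ Real.cosh t - 1 := by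
  have h1 : Real.cosh t = 1 + 2 * Real.sinh (t / 2) ^ 2 := by
    have := Real.cosh_two_mul (t / 2)
    rw [mul_div_cancel₀ t two_ne_zero, Real.cosh_sq] at this
    linarith
  have h2 : (t / 2) ^ 2 ≤ Real.sinh (t / 2) ^ 2 := by
    rw [sq_le_sq, Real.abs_sinh]
    exact Real.self_le_sinh_iff.2 (abs_nonneg _)
  linarith

/-- The right side is `(cosh t - 1) * 2 cosh (β t)`, a factorwise majorant whose terms have
closed-form Gaussian integrals. -/
lemma half_sq_mul_exp_le {β : ℝ} (t : ℝ) :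
    t ^ 2 / 2 * Real.exp (β * |t|) ≤ Real.cosh ((1 + β) * t) + Real.cosh ((1 - β) * t)
      - 2 * Real.cosh (β * t) := by
  have h1 : Real.exp (β * |t|) ≤ 2 * Real.cosh (β * t) := by
    rw [Real.cosh_eq]
    rcases abs_cases t with ⟨h, -⟩ | ⟨h, -⟩ <;> rw [h]
    · linarith [Real.exp_pos (-(β * t))]
    · rw [mul_neg]; linarith [Real.exp_pos (β * t)]
  have h2 : Real.cosh ((1 + β) * t) + Real.cosh ((1 - β) * t) - 2 * Real.cosh (β * t) =
      (Real.cosh t - 1) * (2 * Real.cosh (β * t)) := by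
    rw [add_mul, sub_mul, one_mul, Real.cosh_add, Real.cosh_sub]; ring
  rw [h2]
  have := Real.cosh_pos (β * t)
  exact mul_le_mul (half_sq_le_cosh_sub_one t) h1 (Real.exp_pos _).le
    (by linarith [Real.one_le_cosh t])

lemma integrable_half_sq_mul_exp (β : ℝ) :
    Integrable (fun t : ℝ => t ^ 2 / 2 * Real.exp (β * |t|)) (gaussianReal 0 1) := by
  refine (((integrable_cosh_gaussianReal (1 + β)).add (integrable_cosh_gaussianReal (1 - β))).sub
    ((integrable_cosh_gaussianReal β).const_mul 2)).mono' (by fun_prop) (ae_of_all _ fun t => ?_)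
  rw [Real.norm_of_nonneg (by positivity)]
  exact half_sq_mul_exp_le t

lemma integral_half_sq_mul_exp_le {β : ℝ} (h0 : 0 ≤ β) (h1 : β ≤ 1 / 4) :
    ∫ t, t ^ 2 / 2 * Real.exp (β * |t|) ∂gaussianReal 0 1 ≤ 3 / 2 := by
  have hi := integrable_cosh_gaussianReal
  calc _ ≤ ∫ t, (Real.cosh ((1 + β) * t) + Real.cosh ((1 - β) * t)
      - 2 * Real.cosh (β * t)) ∂gaussianReal 0 1 :=
        integral_mono (integrable_half_sq_mul_exp β)
          (((hi _).add (hi _)).sub ((hi _).const_mul 2)) half_sq_mul_exp_le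
    _ = Real.exp ((1 + β) ^ 2 / 2) + Real.exp ((1 - β) ^ 2 / 2) - 2 * Real.exp (β ^ 2 / 2) := by
        have h := integral_sub ((hi (1 + β)).add (hi (1 - β))) ((hi β).const_mul 2)
        simp only [Pi.add_apply] at h
        rw [h, integral_add (hi _) (hi _), integral_const_mul]
        simp only [integral_cosh_gaussianReal]
    _ = Real.exp (β ^ 2 / 2) * (Real.exp (1 / 2) * (Real.exp β + Real.exp (-β)) - 2) := by
        rw [mul_sub, mul_add, mul_add, ← Real.exp_add, ← Real.exp_add, ← Real.exp_add,
          ← Real.exp_add]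
        ring_nf
    -- Here `33/20` bounds `√e`, and `32/31 = 1/(1 - 1/32)` bounds `exp (1/32)`, with `β²/2 ≤ 1/32`.
    _ ≤ 32 / 31 * (33 / 20 * (2 * (32 / 31)) - 2) := by
        have ha : Real.exp (1 / 2) ≤ 33 / 20 := by
          have := Real.exp_one_lt_d9
          have h2 : Real.exp (1 / 2) ^ 2 = Real.exp 1 := by
            rw [← Real.exp_nat_mul]; norm_num
          nlinarith [Real.exp_pos (1 / 2)]
        have hb : Real.exp (β ^ 2 / 2) ≤ 32 / 31 := by
          have h2 : Real.exp (β ^ 2 / 2) ≤ Real.exp (1 / 32) :=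
            Real.exp_le_exp.2 (by nlinarith)
          have h3 := Real.add_one_le_exp (-(1 / 32) : ℝ)
          have h4 : Real.exp (1 / 32) * Real.exp (-(1 / 32)) = 1 := by
            rw [← Real.exp_add]; simp
          nlinarith [Real.exp_pos (1 / 32)]
        have hc : Real.exp β + Real.exp (-β) ≤ 2 * (32 / 31) := by
          have := Real.cosh_le_exp_half_sq β
          rw [Real.cosh_eq] at this
          linarith
        have hd : Real.exp (1 / 2) * (Real.exp β + Real.exp (-β)) ≤ 33 / 20 * (2 * (32 / 31)) :=
          mul_le_mul ha hc (by positivity) (by norm_num)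
        exact (mul_le_mul_of_nonneg_left (sub_le_sub_right hd 2) (Real.exp_pos _).le).trans
          (mul_le_mul_of_nonneg_right hb (by norm_num))
    _ ≤ 3 / 2 := by norm_num

/-- From `e^{-x} ≥ 1 - x` and `|t| ≤ (1 + t²)/2`, the integral is at least `1 - β`. -/
lemma integral_exp_neg_mul_abs_ge {β : ℝ} (h0 : 0 ≤ β) (h1 : β ≤ 1 / 4) :
    3 / 4 ≤ ∫ t, Real.exp (-(β * |t|)) ∂gaussianReal 0 1 := by
  have hi : Integrable (fun t : ℝ => Real.exp (-(β * |t|))) (gaussianReal 0 1) :=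
    (integrable_const (1 : ℝ)).mono' (by fun_prop) (ae_of_all _ fun t => by
      rw [Real.norm_of_nonneg (Real.exp_pos _).le]
      exact Real.exp_le_one_iff.2 (by have := abs_nonneg t; nlinarith))
  calc (3 / 4 : ℝ) ≤ 1 - β / 2 - β / 2 * 1 := by linarith
    _ = ∫ t, (1 - β / 2 - β / 2 * t ^ 2) ∂gaussianReal 0 1 := by
        rw [integral_sub (integrable_const _) (integrable_sq_gaussianReal.const_mul _),
          integral_const_mul, integral_sq_gaussianReal]
        simp
    _ ≤ _ := by
        refine integral_mono ((integrable_const _).sub (integrable_sq_gaussianReal.const_mul _))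
          hi fun t => ?_
        have h2 := Real.add_one_le_exp (-(β * |t|))
        have h3 : |t| ≤ (1 + t ^ 2) / 2 := by
          nlinarith [sq_nonneg (|t| - 1), sq_abs t]
        have h4 := mul_le_mul_of_nonneg_left h3 h0
        dsimp only
        linarith

/-- A function on the line whose logarithm is Lipschitz with a small constant does not lose much
mass by cancellation under Gaussian averaging. -/
lemma norm_integral_ge_of_logLipschitz {g : ℝ → ℂ} {β : ℝ} (h0 : 0 ≤ β) (h1 : β ≤ 1 / 4)
    (hg : Integrable g (gaussianReal 0 1)) (hg0 : g 0 ≠ 0)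
    (hlog : ∀ t, ∃ z : ℂ, g t = g 0 * Complex.exp z ∧ ‖z‖ ≤ β * |t|) :
    (1 - 2 * β ^ 2) * ∫ t, ‖g t‖ ∂gaussianReal 0 1 ≤ ‖∫ t, g t ∂gaussianReal 0 1‖ ∧
      0 < ∫ t, ‖g t‖ ∂gaussianReal 0 1 := by
  choose z hz hzb using hlog
  have hpos : 0 < ‖g 0‖ := norm_pos_iff.2 hg0
  have hnorm : ∀ t, ‖g t‖ = ‖g 0‖ * Real.exp (z t).re := fun t => by
    rw [hz t, norm_mul, Complex.norm_exp]
  have hlow : ‖g 0‖ * (3 / 4) ≤ ∫ t, ‖g t‖ ∂gaussianReal 0 1 := by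
    refine (mul_le_mul_of_nonneg_left (integral_exp_neg_mul_abs_ge h0 h1) hpos.le).trans ?_
    rw [← integral_const_mul]
    refine integral_mono_of_nonneg (ae_of_all _ fun t => by positivity) hg.norm
      (ae_of_all _ fun t => ?_)
    dsimp only
    rw [hnorm t]
    refine mul_le_mul_of_nonneg_left (Real.exp_le_exp.2 ?_) hpos.le
    linarith [hzb t, neg_abs_le (z t).re, Complex.abs_re_le_norm (z t)]
  refine ⟨?_, by linarith⟩
  -- Rotate by the phase of `g 0`; the remaining argument is at most `β |t|`, and `cos y ≥ 1 - y²/2`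
  -- bounds the loss.
  have hre : ∀ t, ‖g t‖ - ‖g 0‖ * β ^ 2 * (t ^ 2 / 2 * Real.exp (β * |t|)) ≤
      (g t / (g 0 / ‖g 0‖)).re := by
    intro t
    have h3 : g t / (g 0 / ‖g 0‖) = ((‖g 0‖ : ℝ) : ℂ) * Complex.exp (z t) := by
      have : (‖g 0‖ : ℂ) ≠ 0 := by exact_mod_cast hpos.ne'
      rw [hz t]; field_simp
    rw [h3, Complex.re_ofReal_mul, Complex.exp_re, hnorm]
    have h4 := Real.one_sub_sq_div_two_le_cos (x := (z t).im)
    have h5 : (z t).im ^ 2 ≤ β ^ 2 * t ^ 2 := by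
      rw [← sq_abs t, ← mul_pow, ← sq_abs (z t).im]
      gcongr
      exact (Complex.abs_im_le_norm _).trans (hzb t)
    have h6 : Real.exp (z t).re ≤ Real.exp (β * |t|) :=
      Real.exp_le_exp.2 ((Complex.re_le_norm _).trans (hzb t))
    have h7 : Real.exp (z t).re - β ^ 2 * (t ^ 2 / 2 * Real.exp (β * |t|)) ≤
        Real.exp (z t).re * Real.cos (z t).im := by
      calc _ ≤ Real.exp (z t).re - β ^ 2 * (t ^ 2 / 2 * Real.exp (z t).re) := by gcongr
        _ = Real.exp (z t).re * (1 - β ^ 2 * t ^ 2 / 2) := by ring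
        _ ≤ _ := by gcongr; linarith
    have := mul_le_mul_of_nonneg_left h7 hpos.le
    linarith
  have hunit : ‖g 0 / (‖g 0‖ : ℂ)‖ = 1 := by
    rw [norm_div, Complex.norm_real, norm_norm, div_self hpos.ne']
  have hcomb : ∫ t, (‖g t‖ - ‖g 0‖ * β ^ 2 * (t ^ 2 / 2 * Real.exp (β * |t|))) ∂gaussianReal 0 1 ≤
      ‖∫ t, g t ∂gaussianReal 0 1‖ := by
    calc _ ≤ ∫ t, (g t / (g 0 / ‖g 0‖)).re ∂gaussianReal 0 1 :=
          integral_mono (hg.norm.sub ((integrable_half_sq_mul_exp β).const_mul _))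
            (hg.div_const _).re hre
      _ = (∫ t, g t / (g 0 / ‖g 0‖) ∂gaussianReal 0 1).re := integral_re (hg.div_const _)
      _ ≤ ‖∫ t, g t / (g 0 / ‖g 0‖) ∂gaussianReal 0 1‖ := Complex.re_le_norm _
      _ = _ := by rw [integral_div, norm_div, hunit, div_one]
  rw [integral_sub hg.norm ((integrable_half_sq_mul_exp β).const_mul _), integral_const_mul]
    at hcomb
  -- The loss is at most `(3/2) β² ‖g 0‖`, while the mass is at least `(3/4) ‖g 0‖`; the quotient
  -- gives `2 β²`.
  have h8 := mul_le_mul_of_nonneg_left (integral_half_sq_mul_exp_le h0 h1)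
    (mul_nonneg hpos.le (sq_nonneg β))
  have h9 := mul_le_mul_of_nonneg_left hlow (sq_nonneg β)
  linarith

/-! ### Logarithms along a path, and differentiation under the integral. -/

/-- Integrating `F'/F` produces the logarithm without choosing a branch. -/
lemma exists_eq_mul_exp_of_norm_deriv_le {F F' : ℝ → ℂ} {B : ℝ}
    (hF : ∀ τ, HasDerivAt F (F' τ) τ) (hF' : Continuous F')
    (hne : ∀ τ ∈ Set.Icc (0 : ℝ) 1, F τ ≠ 0)
    (hB : ∀ τ ∈ Set.Icc (0 : ℝ) 1, ‖F' τ‖ ≤ B * ‖F τ‖) :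
    ∃ z : ℂ, F 1 = F 0 * Complex.exp z ∧ ‖z‖ ≤ B := by
  have hFc : Continuous F := continuous_iff_continuousAt.2 fun τ => (hF τ).continuousAt
  -- Clamping to `[0, 1]` keeps the quotient continuous on the whole line, since `F` may vanish
  -- outside.
  set p : ℝ → ℝ := fun τ => max 0 (min 1 τ) with hp
  have hpc : Continuous p := by fun_prop
  have hpm : ∀ τ, p τ ∈ Set.Icc (0 : ℝ) 1 := fun τ => by simp [hp]
  have hpe : ∀ τ ∈ Set.Icc (0 : ℝ) 1, p τ = τ := fun τ hτ => by simp [hp, hτ.1, hτ.2]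
  set v : ℝ → ℂ := fun τ => F' (p τ) / F (p τ) with hv
  have hvc : Continuous v :=
    (hF'.comp hpc).div (hFc.comp hpc) fun τ => hne _ (hpm τ)
  have hvB : ∀ τ, ‖v τ‖ ≤ B := fun τ => by
    rw [hv, norm_div, div_le_iff₀ (norm_pos_iff.2 (hne _ (hpm τ)))]
    exact hB _ (hpm τ)
  set u : ℝ → ℂ := fun τ => ∫ s in (0 : ℝ)..τ, v s with hu
  have hud : ∀ τ, HasDerivAt u (v τ) τ := fun τ =>
    intervalIntegral.integral_hasDerivAt_right (hvc.intervalIntegrable _ _)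
      hvc.aestronglyMeasurable.stronglyMeasurableAtFilter hvc.continuousAt
  have hW : ∀ τ ∈ Set.Ico (0 : ℝ) 1,
      HasDerivWithinAt (fun τ => F τ * Complex.exp (-u τ)) 0 (Set.Ici τ) τ := by
    intro τ hτ
    have hτ' : τ ∈ Set.Icc (0 : ℝ) 1 := ⟨hτ.1, hτ.2.le⟩
    have h := ((hF τ).mul (hud τ).neg.cexp).hasDerivWithinAt (s := Set.Ici τ)
    refine h.congr_deriv ?_
    have := hne τ hτ'
    simp only [hv, hpe τ hτ', Pi.neg_apply]
    field_simp
    ring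
  have hcont : Continuous fun τ => F τ * Complex.exp (-u τ) :=
    hFc.mul (continuous_iff_continuousAt.2 fun τ => (hud τ).neg.cexp.continuousAt)
  have h1 := constant_of_has_deriv_right_zero hcont.continuousOn hW 1 (by simp)
  have hu0 : u 0 = 0 := by simp [hu]
  refine ⟨u 1, ?_, ?_⟩
  · rw [hu0, neg_zero, Complex.exp_zero, mul_one] at h1
    rw [← h1, mul_assoc, ← Complex.exp_add, neg_add_cancel, Complex.exp_zero, mul_one]
  · have := intervalIntegral.norm_integral_le_of_norm_le_const (a := 0) (b := 1) (f := v)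
      (C := B) (fun s _ => hvB s)
    simpa [hu] using this

lemma hasDerivAt_integral_mul_exp {α : Type*} [MeasurableSpace α] {μ : Measure α} {u D : α → ℂ}
    {M : ℝ} (hu : Integrable u μ) (hD : AEStronglyMeasurable D μ) (hM : ∀ x, ‖D x‖ ≤ M) (τ : ℝ) :
    HasDerivAt (fun τ : ℝ => ∫ x, u x * Complex.exp (τ * D x) ∂μ)
      (∫ x, u x * D x * Complex.exp (τ * D x) ∂μ) τ := by
  have hexp : ∀ σ : ℝ, ∀ x, ‖Complex.exp (σ * D x)‖ ≤ Real.exp (|σ| * M) := by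
    intro σ x
    refine (Complex.norm_exp_le_exp_norm _).trans (Real.exp_le_exp.2 ?_)
    rw [norm_mul, Complex.norm_real, Real.norm_eq_abs]
    exact mul_le_mul_of_nonneg_left (hM x) (abs_nonneg σ)
  have hmeas : ∀ σ : ℝ, AEStronglyMeasurable (fun x => Complex.exp (σ * D x)) μ := fun σ =>
    Complex.continuous_exp.comp_aestronglyMeasurable (hD.const_mul _)
  refine (hasDerivAt_integral_of_dominated_loc_of_deriv_le
    (F := fun (τ : ℝ) x => u x * Complex.exp (τ * D x))
    (F' := fun (τ : ℝ) x => u x * D x * Complex.exp (τ * D x))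
    (bound := fun x => ‖u x‖ * M * Real.exp ((|τ| + 1) * M))
    (Metric.ball_mem_nhds τ one_pos) ?_ ?_ ?_ ?_ ?_ ?_).2
  · exact .of_forall fun σ => hu.1.mul (hmeas σ)
  · exact hu.mul_bdd (c := Real.exp (|τ| * M)) (hmeas τ) (ae_of_all _ (hexp τ))
  · exact (hu.1.mul hD).mul (hmeas τ)
  · refine ae_of_all _ fun x σ hσ => ?_
    have hM0 : 0 ≤ M := (norm_nonneg _).trans (hM x)
    rw [norm_mul, norm_mul]
    gcongr
    · exact hM x
    · refine (hexp σ x).trans (Real.exp_le_exp.2 (mul_le_mul_of_nonneg_right ?_ hM0))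
      rw [Metric.mem_ball, Real.dist_eq] at hσ
      have := abs_sub_abs_le_abs_sub σ τ
      linarith
  · exact (hu.norm.mul_const _).mul_const _
  · refine ae_of_all _ fun x σ _ => ?_
    have h1 : HasDerivAt (fun σ : ℝ => (σ : ℂ) * D x) (D x) σ := by
      simpa using (Complex.ofRealCLM.hasDerivAt (x := σ)).mul_const (D x)
    exact (h1.cexp.const_mul (u x)).congr_deriv (by ring)

/-! ### Local families and the induction on the set of integrated coordinates. -/

section LocalFamily

variable {ι κ : Type*} [Fintype ι] [DecidableEq ι] [Fintype κ]

/-- A family of functions, 1-Lipschitz in the `ℓ¹` metric, the `i`-th of which depends only on the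
coordinates in `J i`. -/
structure LocalFamily (J : κ → Finset ι) (φ : κ → (ι → ℝ) → ℂ) : Prop where
  lipschitz : ∀ i x y, ‖φ i x - φ i y‖ ≤ ∑ j, |x j - y j|
  dependsOn : ∀ i x y, (∀ j ∈ J i, x j = y j) → φ i x = φ i y

/-- The function `exp (lam * ∑ i, φ i)`. -/
noncomputable def expSum (lam : ℂ) (φ : κ → (ι → ℝ) → ℂ) (x : ι → ℝ) : ℂ :=
  Complex.exp (lam * ∑ i, φ i x)

variable {J : κ → Finset ι} {φ : κ → (ι → ℝ) → ℂ}

omit [DecidableEq ι] [Fintype κ] in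
lemma LocalFamily.continuous (hφ : LocalFamily J φ) (i : κ) : Continuous (φ i) := by
  refine continuous_iff_continuousAt.2 fun y => ?_
  rw [ContinuousAt, tendsto_iff_norm_sub_tendsto_zero]
  refine squeeze_zero (fun _ => norm_nonneg _) (fun x => hφ.lipschitz i x y) ?_
  have : Continuous fun x : ι → ℝ => ∑ j, |x j - y j| := by fun_prop
  simpa using this.tendsto y

omit [DecidableEq ι] in
lemma LocalFamily.expGrowth_expSum (hφ : LocalFamily J φ) (lam : ℂ) :
    ExpGrowth (expSum lam φ) := by
  refine ⟨?_, Real.exp (‖lam‖ * ∑ i, ‖φ i 0‖), ‖lam‖ * Fintype.card κ, by positivity,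
    by positivity, fun x => ?_⟩
  · have := hφ.continuous
    exact (show Continuous (expSum lam φ) by unfold expSum; fun_prop).stronglyMeasurable
  · rw [← Real.exp_add, mul_assoc, ← mul_add]
    refine (Complex.norm_exp_le_exp_norm _).trans (Real.exp_le_exp.2 ?_)
    rw [norm_mul]
    refine mul_le_mul_of_nonneg_left ((norm_sum_le _ _).trans ?_) (norm_nonneg _)
    calc ∑ i, ‖φ i x‖ ≤ ∑ i, (‖φ i 0‖ + ∑ j, |x j|) := by
          refine Finset.sum_le_sum fun i _ => ?_
          have h1 := hφ.lipschitz i x 0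
          simp only [Pi.zero_apply, sub_zero] at h1
          have h2 := norm_sub_norm_le (φ i x) (φ i 0)
          linarith
      _ = _ := by rw [Finset.sum_add_distrib]; simp

omit [DecidableEq ι] in
lemma ExpGrowth.bounded_mul {h D : (ι → ℝ) → ℂ} {M : ℝ} (hh : ExpGrowth h)
    (hD : StronglyMeasurable D) (hM : ∀ x, ‖D x‖ ≤ M) : ExpGrowth (fun x => D x * h x) := by
  obtain ⟨C, K, hC, hK, hb⟩ := hh.bound
  have hM0 : 0 ≤ M := (norm_nonneg _).trans (hM 0)
  refine ⟨hD.mul hh.1, M * C, K, by positivity, hK, fun x => ?_⟩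
  rw [norm_mul, mul_assoc]
  exact mul_le_mul (hM x) (hb x) (norm_nonneg _) hM0

/-- `D` does not see the coordinates in `S \ A`, so it factors out of the inner expectation before
moduli are taken. -/
lemma norm_partialExp_mul_le {h D : (ι → ℝ) → ℂ} {M : ℝ} (hh : ExpGrowth h)
    (hD : StronglyMeasurable D) (hM : ∀ x, ‖D x‖ ≤ M) {S A : Finset ι} (hA : A ⊆ S)
    (hdep : ∀ x y, (∀ j ∉ S \ A, x j = y j) → D x = D y) (x : ι → ℝ) :
    ‖partialExp S (fun w => D w * h w) x‖ ≤
      M * partialExp A (fun w => ‖partialExp (S \ A) h w‖) x := by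
  have hin : ∀ w, partialExp (S \ A) (fun w => D w * h w) w =
      D w * partialExp (S \ A) h w := by
    intro w
    unfold partialExp
    rw [← integral_const_mul]
    refine integral_congr_ae (ae_of_all _ fun y => ?_)
    dsimp only
    rw [hdep _ w fun j hj => Finset.piecewise_eq_of_notMem _ _ _ hj]
  have hS : A ∪ S \ A = S := Finset.union_sdiff_of_subset hA
  have := partialExp_union (hh.bounded_mul hD hM) A (S \ A) x
  rw [hS] at this
  rw [this, funext hin]
  unfold partialExp
  rw [← integral_const_mul]
  refine norm_integral_le_of_norm_le
    (((hh.partialExp (S \ A)).norm.integrable_piecewise A x).const_mul M)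
    (ae_of_all _ fun y => ?_)
  rw [norm_mul]
  exact mul_le_mul_of_nonneg_right (hM _) (norm_nonneg _)

-- A convex combination of two restrictions at `x j = s` and `x j = t` stays in the class, so the
-- inductive bound applies along the whole path.
omit [Fintype κ] in
lemma LocalFamily.interpolate (hφ : LocalFamily J φ) (j : ι) (s t : ℝ) {τ : ℝ}
    (hτ : τ ∈ Set.Icc (0 : ℝ) 1) :
    LocalFamily J fun i w => φ i (Function.update w j s) +
      τ * (φ i (Function.update w j t) - φ i (Function.update w j s)) := by
  have hupd : ∀ (u : ℝ) (x y : ι → ℝ),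
      ∑ k, |Function.update x j u k - Function.update y j u k| ≤ ∑ k, |x k - y k| := by
    intro u x y
    refine Finset.sum_le_sum fun k _ => ?_
    by_cases hk : k = j
    · subst hk; simp
    · simp [hk]
  refine ⟨fun i x y => ?_, fun i x y hxy => ?_⟩
  · have hs := (hφ.lipschitz i (Function.update x j s) (Function.update y j s)).trans (hupd s x y)
    have ht := (hφ.lipschitz i (Function.update x j t) (Function.update y j t)).trans (hupd t x y)
    have heq : φ i (Function.update x j s) +
          τ * (φ i (Function.update x j t) - φ i (Function.update x j s)) -
        (φ i (Function.update y j s) +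
          τ * (φ i (Function.update y j t) - φ i (Function.update y j s))) =
        ((1 - τ : ℝ) : ℂ) * (φ i (Function.update x j s) - φ i (Function.update y j s)) +
        ((τ : ℝ) : ℂ) * (φ i (Function.update x j t) - φ i (Function.update y j t)) := by
      push_cast; ring
    rw [heq]
    refine (norm_add_le _ _).trans ?_
    rw [norm_mul, norm_mul, Complex.norm_of_nonneg (by linarith [hτ.2]),
      Complex.norm_of_nonneg hτ.1]
    have h1 := mul_le_mul_of_nonneg_left hs (sub_nonneg.2 hτ.2)
    have h2 := mul_le_mul_of_nonneg_left ht hτ.1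
    linarith
  · have h : ∀ u : ℝ, φ i (Function.update x j u) = φ i (Function.update y j u) := fun u =>
      hφ.dependsOn i _ _ fun k hk => by
        by_cases hkj : k = j
        · subst hkj; simp
        · simp [hkj, hxy k hk]
    rw [h, h]

/-- The expectation over the coordinates in `S` dominates, up to a factor `q` for each coordinate
in `A ⊆ S`, the expectation over `A` of the modulus of the expectation over `S \ A`. -/
def HasLittleCancellation (J : κ → Finset ι) (lam : ℂ) (q : ℝ) (S : Finset ι) : Prop :=
  ∀ φ : κ → (ι → ℝ) → ℂ, LocalFamily J φ → ∀ x, partialExp S (expSum lam φ) x ≠ 0 ∧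
    ∀ A ⊆ S, q ^ A.card * partialExp A (fun w => ‖partialExp (S \ A) (expSum lam φ) w‖) x ≤
      ‖partialExp S (expSum lam φ) x‖

lemma partialExp_norm_nonneg (A : Finset ι) (h : (ι → ℝ) → ℂ) (x : ι → ℝ) :
    0 ≤ partialExp A (fun w => ‖h w‖) x :=
  integral_nonneg fun _ => norm_nonneg _

lemma HasLittleCancellation.exists_log {lam : ℂ} {q : ℝ} {S : Finset ι} {r c : ℕ}
    (hS : HasLittleCancellation J lam q S) (hq0 : 0 < q) (hq1 : q ≤ 1)
    (hJr : ∀ i, (J i).card ≤ r)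
    (hJc : ∀ j, (Finset.univ.filter fun i => j ∈ J i).card ≤ c)
    (hφ : LocalFamily J φ) {j : ι} (hj : j ∉ S) (x : ι → ℝ) (s t : ℝ) :
    ∃ z : ℂ, partialExp S (expSum lam φ) (Function.update x j t) =
        partialExp S (expSum lam φ) (Function.update x j s) * Complex.exp z ∧
      ‖z‖ ≤ ‖lam‖ * c * q⁻¹ ^ (r - 1) * |t - s| := by
  set D : κ → (ι → ℝ) → ℂ := fun i w =>
    φ i (Function.update w j t) - φ i (Function.update w j s) with hDdef
  have hcont := hφ.continuous
  have hDc : ∀ i, Continuous (D i) := fun i => by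
    have h : ∀ u : ℝ, Continuous fun w : ι → ℝ => Function.update w j u := fun u =>
      continuous_id.update j continuous_const
    exact ((hcont i).comp (h t)).sub ((hcont i).comp (h s))
  have hDle : ∀ i w, ‖D i w‖ ≤ |t - s| := fun i w => by
    refine (hφ.lipschitz i _ _).trans_eq ?_
    rw [Finset.sum_eq_single j]
    · simp
    · intro k _ hk; simp [hk]
    · simp
  have hD0 : ∀ i, j ∉ J i → D i = 0 := fun i hi => by
    ext w
    refine sub_eq_zero.2 (hφ.dependsOn i _ _ fun k hk => ?_)
    have : k ≠ j := fun h => hi (h ▸ hk)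
    simp [this]
  have hDdep : ∀ i x y, (∀ k ∈ J i, x k = y k) → D i x = D i y := fun i x y hxy => by
    have h : ∀ u : ℝ, φ i (Function.update x j u) = φ i (Function.update y j u) := fun u =>
      hφ.dependsOn i _ _ fun k hk => by
        by_cases hkj : k = j
        · subst hkj; simp
        · simp [hkj, hxy k hk]
    simp only [hDdef, h]
  set ψ : ℝ → κ → (ι → ℝ) → ℂ := fun τ i w =>
    φ i (Function.update w j s) + τ * D i w with hψdef
  have hψ : ∀ τ ∈ Set.Icc (0 : ℝ) 1, LocalFamily J (ψ τ) := fun τ hτ => hφ.interpolate j s t hτ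
  have hψexp : ∀ τ w, expSum lam (ψ τ) w =
      expSum lam (ψ 0) w * Complex.exp (τ * (lam * ∑ i, D i w)) := fun τ w => by
    simp only [expSum, hψdef, ← Complex.exp_add]
    congr 1
    rw [Finset.sum_add_distrib, Finset.sum_add_distrib, ← Finset.mul_sum, ← Finset.mul_sum]
    push_cast
    ring
  have hupd : ∀ (u : ℝ) (y : ι → ℝ), S.piecewise y (Function.update x j u) =
      Function.update (S.piecewise y x) j u := fun u y =>
    (Finset.update_piecewise_of_notMem (hi := hj) ..).symm
  have hend : ∀ (τ u : ℝ), (∀ i w, ψ τ i w = φ i (Function.update w j u)) →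
      partialExp S (expSum lam (ψ τ)) x = partialExp S (expSum lam φ) (Function.update x j u) := by
    intro τ u h
    simp only [partialExp, expSum, h, hupd]
  have hgrow0 := (hψ 0 (by simp)).expGrowth_expSum lam
  set d : (ι → ℝ) → ℂ := fun y => lam * ∑ i, D i (S.piecewise y x) with hddef
  have hdm : StronglyMeasurable d := by
    have hm : StronglyMeasurable fun w => lam * ∑ i, D i w :=
      (show Continuous fun w => lam * ∑ i, D i w by fun_prop).stronglyMeasurable
    exact hm.comp_measurable ((measurable_piecewise_prod S).comp measurable_prodMk_right)
  have hdle : ∀ y, ‖d y‖ ≤ ‖lam‖ * ∑ _i : κ, |t - s| := fun y => by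
    rw [hddef, norm_mul]
    exact mul_le_mul_of_nonneg_left ((norm_sum_le _ _).trans
      (Finset.sum_le_sum fun i _ => hDle i _)) (norm_nonneg _)
  set u : (ι → ℝ) → ℂ := fun y => expSum lam (ψ 0) (S.piecewise y x) with hudef
  have hui : Integrable u (gaussPi ι) := hgrow0.integrable_piecewise S x
  have hudi : Integrable (fun y => u y * d y) (gaussPi ι) :=
    hui.mul_bdd hdm.aestronglyMeasurable (ae_of_all _ hdle)
  have hF := hasDerivAt_integral_mul_exp hui hdm.aestronglyMeasurable hdle
  -- Differentiating once more gives continuity of the first derivative.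
  have hF2 := hasDerivAt_integral_mul_exp hudi hdm.aestronglyMeasurable hdle
  have hFeq : ∀ τ : ℝ, ∫ y, u y * Complex.exp (τ * d y) ∂gaussPi ι =
      partialExp S (expSum lam (ψ τ)) x := fun τ => by
    simp only [partialExp, hψexp τ, hudef, hddef]
  have hFeq' : ∀ τ ∈ Set.Icc (0 : ℝ) 1, ∫ y, u y * d y * Complex.exp (τ * d y) ∂gaussPi ι =
      lam * ∑ i, partialExp S (fun w => D i w * expSum lam (ψ τ) w) x := fun τ hτ => by
    have hi : ∀ i, Integrable (fun y => D i (S.piecewise y x) *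
        expSum lam (ψ τ) (S.piecewise y x)) (gaussPi ι) := fun i =>
      (((hψ τ hτ).expGrowth_expSum lam).bounded_mul (hDc i).stronglyMeasurable
        (hDle i)).integrable_piecewise S x
    unfold partialExp
    rw [← integral_finsetSum _ fun i _ => hi i, ← integral_const_mul]
    refine integral_congr_ae (ae_of_all _ fun y => ?_)
    simp only [hψexp τ, hudef, hddef]
    rw [← Finset.sum_mul]
    ring
  have hderiv : ∀ τ ∈ Set.Icc (0 : ℝ) 1,
      ‖∫ y, u y * d y * Complex.exp (τ * d y) ∂gaussPi ι‖ ≤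
        ‖lam‖ * c * q⁻¹ ^ (r - 1) * |t - s| *
          ‖∫ y, u y * Complex.exp (τ * d y) ∂gaussPi ι‖ := by
    intro τ hτ
    rw [hFeq, hFeq' τ hτ, norm_mul]
    set N := ‖partialExp S (expSum lam (ψ τ)) x‖ with hN
    have hgrow := (hψ τ hτ).expGrowth_expSum lam
    have hterm : ∀ i, ‖partialExp S (fun w => D i w * expSum lam (ψ τ) w) x‖ ≤
        if j ∈ J i then q⁻¹ ^ (r - 1) * |t - s| * N else 0 := by
      intro i
      split_ifs with hi
      -- As `j` lies in `J i` but not in `S`, one coordinate is saved: the exponent is `r - 1`.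
      · have hcard : (S ∩ J i).card ≤ r - 1 := by
          have h1 : S ∩ J i ⊆ (J i).erase j := fun k hk => by
            rw [Finset.mem_inter] at hk
            exact Finset.mem_erase.2 ⟨fun h => hj (h ▸ hk.1), hk.2⟩
          have h2 := Finset.card_le_card h1
          rw [Finset.card_erase_of_mem hi] at h2
          have := hJr i
          omega
        have h1 := norm_partialExp_mul_le hgrow (hDc i).stronglyMeasurable (hDle i)
          (Finset.inter_subset_left : S ∩ J i ⊆ S)
          (fun v w hvw => hDdep i v w fun k hk => hvw k (by simp [hk])) x
        have h2 := (hS _ (hψ τ hτ) x).2 (S ∩ J i) Finset.inter_subset_left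
        set G := partialExp (S ∩ J i)
          (fun w => ‖partialExp (S \ (S ∩ J i)) (expSum lam (ψ τ)) w‖) x with hG
        have hG0 : 0 ≤ G := partialExp_norm_nonneg _ _ _
        have h3 : q ^ (r - 1) * G ≤ N :=
          (mul_le_mul_of_nonneg_right (pow_le_pow_of_le_one hq0.le hq1 hcard) hG0).trans h2
        have h4 : G ≤ q⁻¹ ^ (r - 1) * N := by
          rw [inv_pow, inv_mul_eq_div, le_div_iff₀ (by positivity)]
          linarith
        calc _ ≤ |t - s| * G := h1
          _ ≤ |t - s| * (q⁻¹ ^ (r - 1) * N) := by gcongr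
          _ = _ := by ring
      · simp [hD0 i hi, partialExp]
    have hsum : ‖∑ i, partialExp S (fun w => D i w * expSum lam (ψ τ) w) x‖ ≤
        c * (q⁻¹ ^ (r - 1) * |t - s| * N) := by
      refine (norm_sum_le _ _).trans ((Finset.sum_le_sum fun i _ => hterm i).trans ?_)
      rw [← Finset.sum_filter, Finset.sum_const, nsmul_eq_mul]
      gcongr
      exact hJc j
    refine (mul_le_mul_of_nonneg_left hsum (norm_nonneg lam)).trans_eq ?_
    ring
  obtain ⟨z, hz, hzb⟩ := exists_eq_mul_exp_of_norm_deriv_le hF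
    (continuous_iff_continuousAt.2 fun τ => (hF2 τ).continuousAt)
    (fun τ hτ => by rw [hFeq]; exact (hS _ (hψ τ hτ) x).1)
    hderiv
  refine ⟨z, ?_, hzb⟩
  rw [hFeq, hFeq, hend 1 t (by simp [hψdef, hDdef]), hend 0 s (by simp [hψdef])] at hz
  exact hz

lemma hasLittleCancellation {lam : ℂ} {q : ℝ} {r c : ℕ} (hq0 : 0 < q) (hq1 : q ≤ 1)
    (hJr : ∀ i, (J i).card ≤ r)
    (hJc : ∀ j, (Finset.univ.filter fun i => j ∈ J i).card ≤ c)
    (hβ : ‖lam‖ * c * q⁻¹ ^ (r - 1) ≤ 1 / 4)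
    (hq : q ≤ 1 - 2 * (‖lam‖ * c * q⁻¹ ^ (r - 1)) ^ 2) (S : Finset ι) :
    HasLittleCancellation J lam q S := by
  induction S using Finset.strongInduction with
  | H S ih =>
    intro φ hφ x
    have hgrow := hφ.expGrowth_expSum lam
    -- One coordinate is peeled off: the expectation over `S.erase a` is nonzero and log-Lipschitz
    -- in `x a` by induction, so averaging over `a` costs a factor `q`.
    have hstep : ∀ a ∈ S,
        q * ∫ t, ‖partialExp (S.erase a) (expSum lam φ) (Function.update x a t)‖
            ∂gaussianReal 0 1 ≤ ‖partialExp S (expSum lam φ) x‖ ∧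
          0 < ∫ t, ‖partialExp (S.erase a) (expSum lam φ) (Function.update x a t)‖
            ∂gaussianReal 0 1 := by
      intro a ha
      have h := norm_integral_ge_of_logLipschitz (by positivity) hβ
        ((hgrow.partialExp (S.erase a)).integrable_update a x)
        (ih _ (Finset.erase_ssubset ha) φ hφ _).1
        (fun t => by
          simpa using (ih _ (Finset.erase_ssubset ha)).exists_log hq0 hq1 hJr hJc hφ
            (Finset.notMem_erase a S) x 0 t)
      have hS := partialExp_union hgrow {a} (S.erase a) x
      rw [← Finset.insert_eq, Finset.insert_erase ha,
        partialExp_singleton (hgrow.partialExp _)] at hS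
      rw [hS]
      exact ⟨(mul_le_mul_of_nonneg_right hq h.2.le).trans h.1, h.2⟩
    refine ⟨?_, fun A hA => ?_⟩
    · rcases S.eq_empty_or_nonempty with rfl | ⟨a, ha⟩
      · simp [expSum]
      · obtain ⟨h1, h2⟩ := hstep a ha
        exact norm_pos_iff.1 ((mul_pos hq0 h2).trans_le h1)
    · rcases A.eq_empty_or_nonempty with rfl | ⟨a, ha⟩
      · simp
      · have hG := (hgrow.partialExp (S \ A)).norm
        have hAU := partialExp_union hG {a} (A.erase a) x
        rw [← Finset.insert_eq, Finset.insert_erase ha,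
          partialExp_singleton (hG.partialExp _)] at hAU
        -- Removing `a` from both sets leaves the inner expectation unchanged, so the inductive
        -- bound can be integrated over `x a`.
        have hsd : S.erase a \ A.erase a = S \ A := by
          ext k
          by_cases hk : k = a
          · subst hk; simp [ha]
          · simp [hk]
        have hcard : A.card = (A.erase a).card + 1 := (Finset.card_erase_add_one ha).symm
        rw [hAU, hcard, pow_succ', mul_assoc, ← integral_const_mul]
        refine le_trans (mul_le_mul_of_nonneg_left ?_ hq0.le) (hstep a (hA ha)).1
        refine integral_mono (((hG.partialExp _).integrable_update a x).const_mul _)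
          ((hgrow.partialExp _).norm.integrable_update a x) fun t => ?_
        have := (ih _ (Finset.erase_ssubset (hA ha)) φ hφ (Function.update x a t)).2 (A.erase a)
          (Finset.erase_subset_erase a hA)
        rwa [hsd] at this

end LocalFamily

/-! ### The choice of `q`, and the conclusion. -/

/-- Since `r - 1 ≥ r/2`, `(ℓc)² ≤ 1/(18r)`; and `q^{-2(r-1)} ≤ exp(π²/16) ≤ 2`. Hence `β² ≤ 1/(9r) ≤
1/18`. -/
lemma radius_estimates {r c : ℕ} (hr : 2 ≤ r) (hc : 1 ≤ c) {ℓ : ℝ} (h0 : 0 ≤ ℓ)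
    (hℓ : ℓ < 1 / (6 * (c : ℝ) * Real.sqrt ((r : ℝ) - 1))) :
    ℓ * c * (Real.exp (-(Real.pi ^ 2 / (32 * r))))⁻¹ ^ (r - 1) ≤ 1 / 4 ∧
      Real.exp (-(Real.pi ^ 2 / (32 * r))) ≤
        1 - 2 * (ℓ * c * (Real.exp (-(Real.pi ^ 2 / (32 * r))))⁻¹ ^ (r - 1)) ^ 2 := by
  have hr' : (2 : ℝ) ≤ r := by exact_mod_cast hr
  have hc' : (1 : ℝ) ≤ c := by exact_mod_cast hc
  have hsq : Real.sqrt ((r : ℝ) - 1) ^ 2 = r - 1 := Real.sq_sqrt (by linarith)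
  have hs0 : 0 < Real.sqrt ((r : ℝ) - 1) := Real.sqrt_pos.2 (by linarith)
  have hπ1 := Real.pi_lt_d2
  have hπ2 := Real.pi_gt_d2
  have hlc : (ℓ * c) ^ 2 ≤ 1 / (18 * r) := by
    have h1 : ℓ * c * (6 * Real.sqrt ((r : ℝ) - 1)) ≤ 1 := by
      rw [lt_div_iff₀ (by positivity)] at hℓ
      linarith
    have h2 : (ℓ * c * (6 * Real.sqrt ((r : ℝ) - 1))) ^ 2 ≤ 1 := pow_le_one₀ (by positivity) h1
    rw [mul_pow, mul_pow 6, hsq] at h2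
    rw [le_div_iff₀ (by positivity)]
    nlinarith [sq_nonneg (ℓ * c)]
  have hQ : ((Real.exp (-(Real.pi ^ 2 / (32 * r))))⁻¹ ^ (r - 1)) ^ 2 ≤ 2 := by
    rw [← Real.exp_neg, neg_neg, ← pow_mul, ← Real.exp_nat_mul,
      ← Real.le_log_iff_exp_le two_pos]
    have hcast : (((r - 1) * 2 : ℕ) : ℝ) ≤ 2 * r := by
      have : (r - 1) * 2 ≤ 2 * r := by omega
      exact_mod_cast this
    calc (((r - 1) * 2 : ℕ) : ℝ) * (Real.pi ^ 2 / (32 * r))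
        ≤ 2 * r * (Real.pi ^ 2 / (32 * r)) := by gcongr
      _ = Real.pi ^ 2 / 16 := by field_simp; norm_num
      _ ≤ Real.log 2 := by
        have := Real.log_two_gt_d9
        nlinarith
  set Q := (Real.exp (-(Real.pi ^ 2 / (32 * r))))⁻¹ ^ (r - 1) with hQdef
  have hQ0 : 0 ≤ Q := by positivity
  have hX : (ℓ * c * Q) ^ 2 ≤ 1 / (9 * r) := by
    calc (ℓ * c * Q) ^ 2 = (ℓ * c) ^ 2 * Q ^ 2 := mul_pow _ _ _
      _ ≤ 1 / (18 * r) * 2 := by gcongr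
      _ = _ := by field_simp; norm_num
  have hr9 : 1 / (9 * (r : ℝ)) ≤ 1 / 18 := by
    apply one_div_le_one_div_of_le <;> linarith
  refine ⟨?_, ?_⟩
  · have : 0 ≤ ℓ * c * Q := by positivity
    nlinarith
  · set a := Real.pi ^ 2 / (32 * r) with ha
    set b := 1 / (9 * (r : ℝ)) with hb
    -- With `e^{-a} ≤ 1/(1+a)` it suffices that `(1 - 2b)(1 + a) ≥ 1`. Now `a ≥ 5b/2` gives at least
    -- `1 + b/2 - 5b²`, enough as `b ≤ 1/18`.
    have hab : 5 / 2 * b ≤ a := by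
      have : Real.pi ^ 2 / (32 * r) = Real.pi ^ 2 * 9 / 32 * b := by rw [hb]; field_simp
      rw [ha, this]
      have hb0 : 0 ≤ b := by positivity
      nlinarith [mul_le_mul_of_nonneg_right (show (5 / 2 : ℝ) ≤ Real.pi ^ 2 * 9 / 32 by nlinarith) hb0]
    have hb0 : 0 < b := by positivity
    have h1 := Real.add_one_le_exp a
    have h2 : Real.exp (-a) * Real.exp a = 1 := by rw [← Real.exp_add]; simp
    have h3 : Real.exp (-a) * (1 + a) ≤ 1 := by nlinarith [Real.exp_pos (-a)]
    have h4 : 1 ≤ (1 - 2 * b) * (1 + a) := by nlinarith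
    have h5 : Real.exp (-a) ≤ 1 - 2 * b :=
      le_of_mul_le_mul_right (h3.trans h4) (by linarith)
    linarith

theorem theorem1p2 (n m r c : ℕ) (hr : 2 ≤ r) (hc : 1 ≤ c)
    (φ : Fin m → EuclideanSpace ℝ (Fin n) → ℂ)
    -- each `φ i` is 1-Lipschitz in the `ℓ¹` metric
    (hLip : ∀ (i : Fin m) (x y : EuclideanSpace ℝ (Fin n)),
      ‖φ i x - φ i y‖ ≤ ∑ j : Fin n, |x j - y j|)
    -- `φ i` depends only on the coordinates in `J i`, of which there are at most `r`
    (J : Fin m → Finset (Fin n))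
    (hJdep : ∀ (i : Fin m) (x y : EuclideanSpace ℝ (Fin n)),
      (∀ j ∈ J i, x j = y j) → φ i x = φ i y)
    (hJr : ∀ i : Fin m, (J i).card ≤ r)
    -- each coordinate is used by at most `c` of the functions
    (hJc : ∀ j : Fin n, (Finset.univ.filter (fun i : Fin m => j ∈ J i)).card ≤ c)
    (lam : ℂ) (hlam : ‖lam‖ < 1 / (6 * (c : ℝ) * Real.sqrt ((r : ℝ) - 1))) :
    (∫ x, Complex.exp (lam * ∑ i : Fin m, φ i x)
        ∂(ProbabilityTheory.stdGaussian (EuclideanSpace ℝ (Fin n)))) ≠ 0 ∧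
    ∀ L : ℝ, 0 < L → (∀ (i : Fin m) (x : EuclideanSpace ℝ (Fin n)), ‖φ i x‖ ≤ L) →
      Real.exp (-(‖lam‖ * (m : ℝ) * L)) *
          Real.exp (-(Real.pi ^ 2 * (n : ℝ) / (32 * (r : ℝ)))) ≤
        ‖∫ x, Complex.exp (lam * ∑ i : Fin m, φ i x)
          ∂(ProbabilityTheory.stdGaussian (EuclideanSpace ℝ (Fin n)))‖ ∧
      ‖∫ x, Complex.exp (lam * ∑ i : Fin m, φ i x)
          ∂(ProbabilityTheory.stdGaussian (EuclideanSpace ℝ (Fin n)))‖ ≤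
        Real.exp (‖lam‖ * (m : ℝ) * L) := by
  set φ' : Fin m → (Fin n → ℝ) → ℂ := fun i y => φ i (WithLp.toLp 2 y) with hφ'def
  have hφ' : LocalFamily J φ' :=
    ⟨fun i x y => hLip i (WithLp.toLp 2 x) (WithLp.toLp 2 y),
      fun i x y => hJdep i (WithLp.toLp 2 x) (WithLp.toLp 2 y)⟩
  have hgrow := hφ'.expGrowth_expSum lam
  have hint : ∫ x, Complex.exp (lam * ∑ i : Fin m, φ i x)
        ∂(ProbabilityTheory.stdGaussian (EuclideanSpace ℝ (Fin n))) =
      partialExp Finset.univ (expSum lam φ') 0 := by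
    rw [← map_pi_eq_stdGaussian,
      show (WithLp.toLp 2 : (Fin n → ℝ) → _) = MeasurableEquiv.toLp 2 (Fin n → ℝ) from rfl,
      integral_map_equiv]
    simp [partialExp, expSum, gaussPi, hφ'def]
  obtain ⟨hβ, hq⟩ := radius_estimates hr hc (norm_nonneg lam) hlam
  set q := Real.exp (-(Real.pi ^ 2 / (32 * r))) with hqdef
  have hq1 : q ≤ 1 := Real.exp_le_one_iff.2 (neg_nonpos.2 (by positivity))
  obtain ⟨hne, hlow⟩ :=
    hasLittleCancellation (Real.exp_pos _) hq1 hJr hJc hβ hq Finset.univ φ' hφ' 0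
  rw [hint]
  refine ⟨hne, fun L _ hφL => ?_⟩
  have hsum : ∀ y, ‖lam * ∑ i, φ' i y‖ ≤ ‖lam‖ * m * L := fun y => by
    rw [norm_mul, mul_assoc]
    refine mul_le_mul_of_nonneg_left ((norm_sum_le _ _).trans
      ((Finset.sum_le_sum fun i _ => hφL i _).trans_eq ?_)) (norm_nonneg _)
    simp
  constructor
  -- Taking `A = S = univ` leaves `q ^ n` times the expectation of `|e^{λf}|`, whose integrand is at
  -- least `e^{-|λ|mL}`.
  · have h := hlow Finset.univ subset_rfl
    simp only [Finset.sdiff_self, partialExp_empty, Finset.card_univ, Fintype.card_fin] at h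
    refine le_trans ?_ h
    have hqn : Real.exp (-(Real.pi ^ 2 * (n : ℝ) / (32 * (r : ℝ)))) = q ^ n := by
      rw [hqdef, ← Real.exp_nat_mul]
      congr 1
      ring
    rw [hqn, mul_comm]
    refine mul_le_mul_of_nonneg_left ?_ (by positivity)
    calc Real.exp (-(‖lam‖ * m * L)) =
          ∫ _y, Real.exp (-(‖lam‖ * m * L)) ∂gaussPi (Fin n) := by simp
      _ ≤ _ := by
        refine integral_mono (integrable_const _) (hgrow.norm.integrable_piecewise _ _)
          fun y => ?_
        dsimp only
        rw [expSum, Complex.norm_exp]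
        refine Real.exp_le_exp.2 ?_
        linarith [hsum (Finset.univ.piecewise y 0), neg_abs_le
          (lam * ∑ i, φ' i (Finset.univ.piecewise y 0)).re, Complex.abs_re_le_norm
          (lam * ∑ i, φ' i (Finset.univ.piecewise y 0))]
  · refine (norm_integral_le_of_norm_le_const (ae_of_all _ fun y =>
      (Complex.norm_exp_le_exp_norm _).trans (Real.exp_le_exp.2 (hsum _)))).trans_eq ?_
    simp
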